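/- For an integer $n\ge 0$ let \[ \Theta_n(q,x)=\sum_{j=0}^{n} q^{j(j+1)/2}x^j,\qquad \operatorname{Spec}_n=\{q\in\mathbb C\setminus\{0\}:\ \operatorname{disc}_x\Theta_n(q,x)=0\}, \] where $\operatorname{disc}_x$ is the discriminant with respect to $x$, and for an integer $m\ge0$ let \[ \Psi_m(q)=\sum_{k=0}^{m}(-1)^k(2k+1)\,q^{k(k+1)/2}. \] Then for every $\zeta\in\mathbb C$ with $|\zeta|=1$ there exist non-negative integers $m_s\to\infty$ and points $q_s\in\operatorname{Spec}_{2m_s+1}$ ($s=0,1,2,\dots$) such that $q_s\to\zeta$ as $s\to\infty$. Moreover, the points $q_s$ can be chosen so that, in addition, $\Psi_{m_s}(q_s)=0$ for every $s$. -/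

import Mathlib

open Polynomial Filter Topology

namespace PartialTheta

/-- The truncated partial theta polynomial `Θ_n(q, x) = ∑_{j=0}^n q^{j(j+1)/2} x^j`,
as a polynomial in `x` for a fixed complex number `q`. (The exponents `j(j+1)/2` are integers,
so the division of natural numbers is exact.) -/
noncomputable def truncTheta (n : ℕ) (q : ℂ) : ℂ[X] :=
  ∑ j ∈ Finset.range (n + 1), C (q ^ (j * (j + 1) / 2)) * X ^ j

/-- The truncation spectrum `Spec_n = {q ∈ ℂ^* : disc_x Θ_n(q, x) = 0}`. For `q ≠ 0` the polynomial
`Θ_n(q, x)` has exact degree `n` in `x`, so this is the usual discriminant in degree `n`. -/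
def truncSpec (n : ℕ) : Set ℂ :=
  {q : ℂ | q ≠ 0 ∧ (truncTheta n q).discr = 0}

/-- The polynomial `Ψ_m(q) = ∑_{k=0}^m (-1)^k (2k+1) q^{k(k+1)/2}` in the variable `q`. -/
noncomputable def Psi (m : ℕ) : ℂ[X] :=
  ∑ k ∈ Finset.range (m + 1), C ((-1 : ℂ) ^ k * (2 * (k : ℂ) + 1)) * X ^ (k * (k + 1) / 2)

end PartialTheta

/-! At `x = -q^{-(m+1)}` the terms `m - k` and `m + 1 + k` of `Θ_{2m+1}` cancel, and in `x Θ'` the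
same pairs sum to a nonzero multiple of `Ψ_m(q)`. So zeros of `Ψ_m` give double roots, and they need
only accumulate at every point of the unit circle.

This is a Jentzsch-type argument. Suppose a disc centred just outside the circle and crossing it is
free of zeros for all large `m`. With `d = m(m+1)/2`, the function `Ψ_m(q)/q^d` has a logarithm
there. Divided by `d`, its real part is bounded above on the disc and asymptotically at most `0`
outside the circle. Borel–Carathéodory and three circles (`exists_norm_le_of_re_le`) spread this
smallness over the disc, so `Ψ_m → 0` on its part inside the circle (`tendsto_eval_Psi_zero`). But
there `Ψ_m` converges to a power series with constant term `1`. -/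

namespace PartialTheta

/-! ### Complex-analytic tools. -/

/-- If `f` is holomorphic on a disc, vanishes at the centre, and has real part bounded above there,
then a sufficiently small bound for the real part on a concentric smaller disc makes `f z` small. -/
theorem exists_norm_le_of_re_le {R ρ C δ : ℝ} (hρ : 0 < ρ) (hρR : ρ ≤ R) (hC : 0 < C)
    (hδ : 0 < δ) {z : ℂ} (hz : ‖z‖ < R) :
    ∃ ε > 0, ∀ f : ℂ → ℂ, DifferentiableOn ℂ f (Metric.ball 0 R) → f 0 = 0 →
      (∀ w, ‖w‖ < R → (f w).re ≤ C) → (∀ w, ‖w‖ < ρ → (f w).re ≤ ε) → ‖f z‖ ≤ δ := by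
  have hR : 0 < R := hρ.trans_le hρR
  have hinner : ∀ ε > 0, ∀ f : ℂ → ℂ, DifferentiableOn ℂ f (Metric.ball 0 R) → f 0 = 0 →
      (∀ w, ‖w‖ < ρ → (f w).re ≤ ε) → ∀ w, ‖w‖ ≤ ρ / 2 → ‖f w‖ ≤ 2 * ε := by
    intro ε hε f hf h0 hfε w hw
    have h := Complex.borelCaratheodory_zero hε (hf.mono (Metric.ball_subset_ball hρR))
      (fun w hw => hfε w (by simpa using hw)) hρ (z := w)
      (by simpa using (by linarith : ‖w‖ < ρ)) h0
    refine h.trans ?_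
    rw [div_le_iff₀ (by linarith)]
    nlinarith
  by_cases hzρ : ‖z‖ ≤ ρ / 2
  · refine ⟨δ / 2, by positivity, fun f hf h0 _ hfε => ?_⟩
    have := hinner (δ / 2) (by positivity) f hf h0 hfε z hzρ
    linarith
  push Not at hzρ
  obtain ⟨r, hzr, hrR⟩ := exists_between hz
  have hz0 : 0 < ‖z‖ := by linarith
  have hr0 : 0 < r := by linarith
  set l := Real.log (ρ / 2) with hl
  set u := Real.log r with hu
  have hlz : l < Real.log ‖z‖ := Real.log_lt_log (by positivity) hzρ
  have hzu : Real.log ‖z‖ < u := Real.log_lt_log hz0 hzr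
  set θ := (Real.log ‖z‖ - l) / (u - l) with hθ
  have hθ1 : θ < 1 := by rw [hθ, div_lt_one (by linarith)]; linarith
  set B := 2 * C * r / (R - r) with hB
  -- The three-circles bound tends to `0` with `ε` because the inner weight `1 - θ` is positive.
  have hlim : Tendsto (fun ε : ℝ => (2 * ε) ^ (1 - θ) * B ^ θ) (𝓝[>] 0) (𝓝 0) := by
    have h1 : ContinuousAt (fun ε : ℝ => (2 * ε) ^ (1 - θ) * B ^ θ) 0 := by
      refine ContinuousAt.mul (ContinuousAt.rpow_const (by fun_prop) (Or.inr (by linarith)))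
        continuousAt_const
    have h2 : (2 * (0 : ℝ)) ^ (1 - θ) * B ^ θ = 0 := by
      rw [mul_zero, Real.zero_rpow (by linarith), zero_mul]
    have h3 := h1.tendsto
    rw [h2] at h3
    exact h3.mono_left nhdsWithin_le_nhds
  obtain ⟨ε, hεδ, hε⟩ := ((hlim.eventually_lt_const hδ).and self_mem_nhdsWithin).exists
  refine ⟨ε, hε, fun f hf h0 hfC hfε => le_trans ?_ hεδ.le⟩
  have houter : ∀ w, ‖w‖ ≤ r → ‖f w‖ ≤ B := by
    intro w hw
    have h := Complex.borelCaratheodory_zero hC hf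
      (fun w hw => hfC w (by simpa using hw)) hR (z := w)
      (by simpa using (by linarith : ‖w‖ < R)) h0
    refine h.trans ?_
    rw [hB]
    gcongr
  have hnorm : ∀ w ∈ Complex.HadamardThreeLines.verticalClosedStrip l u, ‖Complex.exp w‖ ≤ r := by
    intro w hw
    rw [Complex.norm_exp, ← Real.exp_log hr0]
    exact Real.exp_le_exp.2 hw.2
  have hdiff : DifferentiableOn ℂ (fun w => f (Complex.exp w)) {w : ℂ | w.re < Real.log R} := by
    refine hf.comp Complex.differentiable_exp.differentiableOn fun w hw => ?_
    rw [mem_ball_zero_iff, Complex.norm_exp, ← Real.exp_log hR]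
    exact Real.exp_lt_exp.2 hw
  have huR : u < Real.log R := Real.log_lt_log hr0 hrR
  have hsub : closure (Complex.HadamardThreeLines.verticalStrip l u) ⊆
      {w : ℂ | w.re < Real.log R} := by
    have hcl : closure (Complex.HadamardThreeLines.verticalStrip l u) ⊆ {w : ℂ | w.re ≤ u} :=
      closure_minimal (fun w hw => le_of_lt hw.2)
        (isClosed_le Complex.continuous_re continuous_const)
    exact fun w hw => lt_of_le_of_lt (hcl hw) huR
  -- Three circles, as three lines pulled back along `exp`.
  have key := Complex.HadamardThreeLines.norm_le_interp_of_mem_verticalClosedStrip'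
    (f := fun w => f (Complex.exp w)) (z := Complex.log z) (a := 2 * ε) (b := B) (l := l) (u := u)
    (by linarith)
    (by
      change (Complex.log z).re ∈ Set.Icc l u
      rw [Complex.log_re]
      exact ⟨hlz.le, hzu.le⟩)
    (hdiff.mono hsub).diffContOnCl
    (by
      refine ⟨B, ?_⟩
      rintro _ ⟨w, hw, rfl⟩
      exact houter _ (hnorm w hw))
    (by
      intro w hw
      refine hinner ε hε f hf h0 hfε _ ?_
      have hw' : w.re = l := hw
      rw [Complex.norm_exp, hw', hl, Real.exp_log (by positivity)])
    (by
      intro w hw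
      refine houter _ ?_
      have hw' : w.re = u := hw
      rw [Complex.norm_exp, hw', hu, Real.exp_log (by positivity)])
  rw [Complex.exp_log (norm_pos_iff.1 hz0), Complex.log_re] at key
  exact key

/-- A nowhere vanishing holomorphic function on a disc has a holomorphic logarithm. -/
theorem exists_eq_mul_exp {F : ℂ → ℂ} {c : ℂ} {R : ℝ}
    (hF : DifferentiableOn ℂ F (Metric.ball c R)) (hF0 : ∀ z ∈ Metric.ball c R, F z ≠ 0) :
    ∃ k : ℂ → ℂ, DifferentiableOn ℂ k (Metric.ball 0 R) ∧ k 0 = 0 ∧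
      ∀ w ∈ Metric.ball (0 : ℂ) R, F (c + w) = F c * Complex.exp (k w) := by
  have hL : DifferentiableOn ℂ (fun z => deriv F z / F z) (Metric.ball c R) :=
    (hF.deriv Metric.isOpen_ball).div hF hF0
  obtain ⟨g, hgc, hg⟩ := hL.isExactOn_ball.with_val_at c 0
  have hmem : ∀ w ∈ Metric.ball (0 : ℂ) R, c + w ∈ Metric.ball c R := by
    intro w hw
    simpa using hw
  refine ⟨fun w => g (c + w), ?_, by simpa using hgc, fun w hw => ?_⟩
  · intro w hw
    exact ((hg _ (hmem w hw)).differentiableAt.comp w (by fun_prop)).differentiableWithinAt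
  · have hd : ∀ z ∈ Metric.ball c R, HasDerivAt (fun z => F z * Complex.exp (-g z)) 0 z := by
      intro z hz
      have h1 : HasDerivAt F (deriv F z) z :=
        (hF.differentiableAt (Metric.isOpen_ball.mem_nhds hz)).hasDerivAt
      have h2 := h1.mul (hg z hz).neg.cexp
      refine h2.congr_deriv ?_
      linear_combination -Complex.exp (-g z) * (mul_div_cancel₀ (deriv F z) (hF0 z hz))
    have hc : c ∈ Metric.ball c R := by
      have := hmem w hw
      exact Metric.mem_ball_self ((Metric.nonempty_ball (x := c)).1 ⟨_, this⟩)
    have hconst := (convex_ball c R).is_const_of_fderivWithin_eq_zero (𝕜 := ℂ)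
      (fun z hz => (hd z hz).differentiableAt.differentiableWithinAt)
      (fun z hz => by
        rw [fderivWithin_of_isOpen Metric.isOpen_ball hz]
        simpa using (hd z hz).hasFDerivAt.fderiv) (hmem w hw) hc
    simp only [hgc, neg_zero, Complex.exp_zero, mul_one] at hconst
    rw [← hconst, mul_assoc, ← Complex.exp_add, neg_add_cancel, Complex.exp_zero, mul_one]

/-! ### From zeros of `Ψ_m` to double roots. -/

theorem discr_eq_zero_of_isRoot_derivative {K : Type*} [Field K] [CharZero K] {f : K[X]}
    (hf : 0 < f.degree) {x : K} (hx : f.IsRoot x) (hx' : f.derivative.IsRoot x) :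
    f.discr = 0 := by
  have hf0 : f ≠ 0 := by rintro rfl; simp at hf
  have hcop : ¬ IsCoprime f f.derivative := by
    rintro ⟨a, b, hab⟩
    have := congrArg (eval x) hab
    simp [hx.eq_zero, hx'.eq_zero] at this
  have hres := resultant_eq_zero_iff.2 ⟨Or.inl hf0, hcop⟩
  rw [natDegree_derivative, resultant_deriv hf] at hres
  simpa [hf0] using hres

theorem coeff_truncTheta (n : ℕ) (q : ℂ) (i : ℕ) :
    (truncTheta n q).coeff i = if i < n + 1 then q ^ (i * (i + 1) / 2) else 0 := by
  simp_rw [truncTheta, finsetSum_coeff, coeff_C_mul, coeff_X_pow]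
  simp

theorem succ_mul_div_two (j : ℕ) : (j + 1) * (j + 1 + 1) / 2 = j * (j + 1) / 2 + (j + 1) := by
  rw [show (j + 1) * (j + 1 + 1) = j * (j + 1) + (j + 1) * 2 by ring,
    Nat.add_mul_div_right _ _ two_pos]

/-- A function on `{0, …, 2m+1}` is summed by pairing `m - k` with `m + 1 + k`. -/
theorem sum_range_pair {M : Type*} [AddCommMonoid M] (f : ℕ → M) (m : ℕ) :
    ∑ j ∈ Finset.range (2 * m + 1 + 1), f j =
      ∑ k ∈ Finset.range (m + 1), (f (m - k) + f (m + 1 + k)) := by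
  rw [show 2 * m + 1 + 1 = (m + 1) + (m + 1) by ring, Finset.sum_range_add, Finset.sum_add_distrib,
    ← Finset.sum_range_reflect]
  simp

/-- Consecutive terms have ratio `q^{j+1} x`. Since `q^{m+1} x = -1`, each step outward from the
centre, up or down, multiplies by `-q^{k+1}`. -/
theorem term_sub_and_add {q : ℂ} (hq : q ≠ 0) (m : ℕ) {x : ℂ} (hx : q ^ (m + 1) * x = -1) :
    ∀ k ≤ m,
      q ^ ((m - k) * (m - k + 1) / 2) * x ^ (m - k) =
        q ^ (m * (m + 1) / 2) * x ^ m * ((-1) ^ k * q ^ (k * (k + 1) / 2)) ∧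
      q ^ ((m + 1 + k) * (m + 1 + k + 1) / 2) * x ^ (m + 1 + k) =
        -(q ^ (m * (m + 1) / 2) * x ^ m * ((-1) ^ k * q ^ (k * (k + 1) / 2))) := by
  have hx0 : x ≠ 0 := by rintro rfl; simp at hx
  intro k
  induction k with
  | zero =>
    intro _
    refine ⟨by simp, ?_⟩
    simp only [add_zero, succ_mul_div_two m]
    linear_combination q ^ (m * (m + 1) / 2) * x ^ m * hx
  | succ k ih =>
    intro hk
    obtain ⟨h1, h2⟩ := ih (by omega)
    obtain ⟨i, rfl⟩ : ∃ i, m = i + (k + 1) := ⟨m - (k + 1), by omega⟩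
    rw [show i + (k + 1) - k = i + 1 by omega] at h1
    rw [show i + (k + 1) - (k + 1) = i by omega]
    rw [succ_mul_div_two i] at h1
    constructor
    · rw [succ_mul_div_two k]
      have hne : q ^ (i + 1) * x ≠ 0 := mul_ne_zero (pow_ne_zero _ hq) hx0
      refine mul_right_cancel₀ hne ?_
      have hx' : q ^ (i + 1) * x * q ^ (k + 1) = -1 := by rw [← hx]; ring
      linear_combination h1 - q ^ ((i + (k + 1)) * (i + (k + 1) + 1) / 2) * x ^ (i + (k + 1)) *
        ((-1) ^ (k + 1) * q ^ (k * (k + 1) / 2)) * hx'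
    · rw [← add_assoc (i + (k + 1) + 1) k 1, succ_mul_div_two (i + (k + 1) + 1 + k),
        succ_mul_div_two k, pow_add q, pow_succ x]
      have hx' : q ^ (i + (k + 1) + 1 + k + 1) * x = -q ^ (k + 1) := by
        linear_combination q ^ (k + 1) * hx
      linear_combination (q ^ (i + (k + 1) + 1 + k + 1) * x) * h2 -
        (q ^ ((i + (k + 1)) * (i + (k + 1) + 1) / 2) * x ^ (i + (k + 1)) *
        ((-1) ^ k * q ^ (k * (k + 1) / 2))) * hx'

theorem eval_Psi (m : ℕ) (q : ℂ) :
    (Psi m).eval q =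
      ∑ k ∈ Finset.range (m + 1), (-1) ^ k * (2 * (k : ℂ) + 1) * q ^ (k * (k + 1) / 2) := by
  simp [Psi, eval_finsetSum]

theorem Psi_eval_zero (m : ℕ) : (Psi m).eval 0 = 1 := by
  rw [eval_Psi, Finset.sum_range_succ', Finset.sum_eq_zero]
  · simp
  · intro k _
    rw [succ_mul_div_two, zero_pow (by omega), mul_zero]

/-- At a zero of `Ψ_m`, the palindromic centre `-q^{-(m+1)}` is a double root of `Θ_{2m+1}(q, ·)`. -/
theorem mem_truncSpec_of_isRoot_Psi {m : ℕ} {q : ℂ} (h : (Psi m).IsRoot q) :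
    q ∈ truncSpec (2 * m + 1) := by
  have hq : q ≠ 0 := by
    rintro rfl
    have := Psi_eval_zero m
    rw [h.eq_zero] at this
    exact zero_ne_one this
  set x : ℂ := -(q ^ (m + 1))⁻¹ with hxdef
  have hx : q ^ (m + 1) * x = -1 := by
    rw [hxdef, mul_neg, mul_inv_cancel₀ (pow_ne_zero _ hq)]
  have hx0 : x ≠ 0 := by intro h0; simp [h0] at hx
  have hpair := term_sub_and_add hq m hx
  refine ⟨hq, discr_eq_zero_of_isRoot_derivative (x := x) ?_ ?_ ?_⟩
  · rw [← natDegree_pos_iff_degree_pos]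
    have : (truncTheta (2 * m + 1) q).coeff (2 * m + 1) ≠ 0 := by
      rw [coeff_truncTheta, if_pos (by omega)]
      exact pow_ne_zero _ hq
    have := le_natDegree_of_ne_zero this
    omega
  · rw [IsRoot, truncTheta, eval_finsetSum, sum_range_pair]
    refine Finset.sum_eq_zero fun k hk => ?_
    obtain ⟨h1, h2⟩ := hpair k (by simpa [Nat.lt_succ_iff] using hk)
    simp only [eval_mul, eval_C, eval_pow, eval_X]
    rw [h1, h2, add_neg_cancel]
  · suffices hs : x * (truncTheta (2 * m + 1) q).derivative.eval x = 0 by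
      exact (mul_eq_zero.1 hs).resolve_left hx0
    have hder : x * (truncTheta (2 * m + 1) q).derivative.eval x =
        ∑ j ∈ Finset.range (2 * m + 1 + 1), (j : ℂ) * (q ^ (j * (j + 1) / 2) * x ^ j) := by
      rw [truncTheta, derivative_sum, eval_finsetSum, Finset.mul_sum]
      refine Finset.sum_congr rfl fun j _ => ?_
      rcases j with _ | j
      · simp
      · simp only [derivative_C_mul_X_pow, eval_mul, eval_C, eval_pow, eval_X, Nat.add_sub_cancel]
        ring
    have hΨ := h.eq_zero
    rw [eval_Psi] at hΨ
    -- The weights `(m - k) - (m + 1 + k) = -(2k + 1)` produce the coefficients of `Ψ_m`.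
    rw [hder, sum_range_pair, ← mul_zero (-(q ^ (m * (m + 1) / 2) * x ^ m)), ← hΨ, Finset.mul_sum]
    refine Finset.sum_congr rfl fun k hk => ?_
    have hk' : k ≤ m := by simpa [Nat.lt_succ_iff] using hk
    obtain ⟨h1, h2⟩ := hpair k hk'
    rw [h1, h2, Nat.cast_sub hk']
    push_cast
    ring

/-! ### Growth of `Ψ_m`. -/

theorem le_mul_succ_div_two (k : ℕ) : k ≤ k * (k + 1) / 2 := by
  rw [Nat.le_div_iff_mul_le two_pos]
  rcases k with _ | k
  · simp
  · nlinarith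

theorem mul_succ_div_two_mono {k m : ℕ} (h : k ≤ m) : k * (k + 1) / 2 ≤ m * (m + 1) / 2 := by
  gcongr

theorem norm_coeff (k : ℕ) : ‖(-1 : ℂ) ^ k * (2 * (k : ℂ) + 1)‖ = 2 * k + 1 := by
  rw [norm_mul, norm_pow, norm_neg, norm_one, one_pow, one_mul]
  exact_mod_cast Complex.norm_natCast (2 * k + 1)

theorem sum_two_mul_add_one (m : ℕ) :
    ∑ k ∈ Finset.range (m + 1), (2 * (k : ℝ) + 1) = (m + 1) ^ 2 := by
  induction m with
  | zero => simp
  | succ m ih => rw [Finset.sum_range_succ, ih]; push_cast; ring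

/-- The factor `a` makes the top power dominate even when `‖q‖ < 1`. -/
theorem norm_eval_Psi_le (m : ℕ) {q : ℂ} {a : ℝ} (ha : 1 ≤ a) (haq : 1 ≤ a * ‖q‖) :
    ‖(Psi m).eval q‖ ≤ (m + 1) ^ 2 * (a * ‖q‖) ^ (m * (m + 1) / 2) := by
  rw [eval_Psi, ← sum_two_mul_add_one, Finset.sum_mul]
  refine (norm_sum_le _ _).trans (Finset.sum_le_sum fun k hk => ?_)
  rw [norm_mul, norm_coeff, norm_pow]
  gcongr
  calc ‖q‖ ^ (k * (k + 1) / 2) ≤ (a * ‖q‖) ^ (k * (k + 1) / 2) := by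
        gcongr
        exact le_mul_of_one_le_left (norm_nonneg _) ha
    _ ≤ _ := pow_le_pow_right₀ haq (mul_succ_div_two_mono (by simpa [Nat.lt_succ_iff] using hk))

/-- The top term beats the sum of all others once `‖q‖^{m+1} ≥ m + 1`. -/
theorem eventually_le_norm_eval_Psi {q : ℂ} (hq : 1 < ‖q‖) :
    ∀ᶠ m : ℕ in atTop, ‖q‖ ^ (m * (m + 1) / 2) ≤ ‖(Psi m).eval q‖ := by
  have hlim := tendsto_pow_const_div_const_pow_of_one_lt 1 hq
  rw [← tendsto_add_atTop_iff_nat 1] at hlim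
  rw [← map_add_atTop_eq_nat 1, eventually_map]
  filter_upwards [hlim.eventually_le_const one_pos] with m hm
  rw [pow_one, div_le_one (by positivity)] at hm
  have hprev := norm_eval_Psi_le m le_rfl (q := q) (by linarith)
  rw [one_mul] at hprev
  have hsucc : (Psi (m + 1)).eval q = (Psi m).eval q +
      (-1) ^ (m + 1) * (2 * ((m + 1 : ℕ) : ℂ) + 1) * q ^ ((m + 1) * (m + 1 + 1) / 2) := by
    rw [eval_Psi, Finset.sum_range_succ, ← eval_Psi]
  have htri := norm_sub_le ((Psi (m + 1)).eval q) ((Psi m).eval q)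
  rw [hsucc, add_sub_cancel_left, ← hsucc, norm_mul, norm_coeff, norm_pow] at htri
  rw [succ_mul_div_two, pow_add] at htri ⊢
  push_cast at htri hm
  set A := ‖q‖ ^ (m * (m + 1) / 2)
  have hA : 0 < A := by positivity
  set B := ‖q‖ ^ (m + 1)
  have h1 : ((m : ℝ) + 1) ^ 2 * A ≤ (2 * (m + 1)) * (A * B) := by
    have h0 : (0 : ℝ) ≤ m + 1 := by positivity
    have : ((m : ℝ) + 1) * ((m + 1) * A) ≤ (m + 1) * (B * A) := by gcongr
    nlinarith [mul_nonneg h0 (mul_nonneg hA.le (by positivity : 0 ≤ B))]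
  nlinarith

theorem eventually_sq_le_exp {ε : ℝ} (hε : 0 < ε) :
    ∀ᶠ m : ℕ in atTop, ((m : ℝ) + 1) ^ 2 ≤ Real.exp (((m * (m + 1) / 2 : ℕ) : ℝ) * ε) := by
  have hlim := tendsto_pow_const_div_const_pow_of_one_lt 2 (Real.one_lt_exp_iff.2 hε)
  rw [← tendsto_add_atTop_iff_nat 1] at hlim
  filter_upwards [hlim.eventually_le_const (Real.exp_pos (-ε))] with m hm
  rw [div_le_iff₀ (by positivity), ← Real.exp_nat_mul, ← Real.exp_add] at hm
  push_cast at hm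
  refine hm.trans (Real.exp_le_exp.2 ?_)
  have : (m : ℝ) ≤ ((m * (m + 1) / 2 : ℕ) : ℝ) := by exact_mod_cast le_mul_succ_div_two m
  nlinarith

/-! ### Zero-free discs and accumulation on the circle. -/

/-- If `Ψ_m` has no zeros in a disc about a point outside the closed unit disc, for all large `m`,
then `Ψ_m → 0` on the part of the disc inside the unit disc. -/
theorem tendsto_eval_Psi_zero {c : ℂ} {R : ℝ} (hc : 1 < ‖c‖) (hR : 0 < R) (hcR : R < ‖c‖) {N : ℕ}
    (hN : ∀ m ≥ N, ∀ q ∈ Metric.ball c R, (Psi m).eval q ≠ 0) {p : ℂ} (hp : p ∈ Metric.ball c R)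
    (hp1 : ‖p‖ < 1) : Tendsto (fun m => (Psi m).eval p) atTop (𝓝 0) := by
  have hnorm : ∀ q ∈ Metric.ball c R, ‖c‖ - R < ‖q‖ := by
    intro q hq
    rw [mem_ball_iff_norm'] at hq
    have := norm_sub_norm_le c q
    linarith
  have hp0 : 0 < ‖p‖ := by linarith [hnorm p hp]
  obtain ⟨a, ha1, haR⟩ : ∃ a : ℝ, 1 < a ∧ 1 ≤ a * (‖c‖ - R) := by
    have h0 : 0 < ‖c‖ - R := by linarith
    refine ⟨1 + (‖c‖ - R)⁻¹, by simpa using h0, ?_⟩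
    rw [add_mul, inv_mul_cancel₀ h0.ne']
    linarith
  -- The disc of radius `ρ` about `c` lies outside the unit circle, where `a` can be replaced by
  -- `1`.
  set ρ := min R (‖c‖ - 1) with hρ
  have hρ0 : 0 < ρ := lt_min hR (by linarith)
  obtain ⟨δ, hδ0, hδp⟩ : ∃ δ : ℝ, 0 < δ ∧ ‖p‖ * Real.exp δ < 1 := by
    have hl := Real.log_neg hp0 hp1
    refine ⟨-Real.log ‖p‖ / 2, by linarith, ?_⟩
    nth_rw 1 [← Real.exp_log hp0]
    rw [← Real.exp_add, Real.exp_lt_one_iff]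
    linarith
  have hpc : ‖p - c‖ < R := by simpa [dist_eq_norm] using hp
  have hla : 0 < Real.log a := Real.log_pos ha1
  -- In `C`, the `1` absorbs `(m+1)^2 ≤ e^d` and `log a` absorbs `a^d`.
  obtain ⟨ε, hε, hsmall⟩ := exists_norm_le_of_re_le (C := 1 + Real.log a) hρ0 (min_le_left _ _)
    (by linarith) hδ0 hpc
  set s := ‖p‖ * Real.exp δ with hs
  have hs0 : 0 < s := by positivity
  have hlim : Tendsto (fun m : ℕ => ((m : ℝ) + 1) ^ 2 * s ^ m) atTop (𝓝 0) := by
    have h := tendsto_pow_const_mul_const_pow_of_abs_lt_one 2 (r := s) (by rwa [abs_of_pos hs0])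
    rw [← tendsto_add_atTop_iff_nat 1] at h
    have h' := h.const_mul s⁻¹
    rw [mul_zero] at h'
    refine h'.congr fun m => ?_
    push_cast
    field_simp
    ring
  refine squeeze_zero_norm' ?_ hlim
  filter_upwards [eventually_le_norm_eval_Psi hc, eventually_sq_le_exp hε,
    eventually_sq_le_exp one_pos, eventually_ge_atTop N, eventually_ge_atTop 1]
    with m hlow hexp hexp1 hmN hm1
  set d := m * (m + 1) / 2 with hd
  have hmd : m ≤ d := le_mul_succ_div_two m
  have hd0 : (0 : ℝ) < d := by exact_mod_cast (by omega : 0 < d)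
  have hne : ∀ q ∈ Metric.ball c R, q ≠ 0 := by
    intro q hq
    have := hnorm q hq
    exact norm_pos_iff.1 (by linarith)
  obtain ⟨k, hk, hk0, hkF⟩ := exists_eq_mul_exp (F := fun q => (Psi m).eval q / q ^ d) (c := c)
    (R := R)
    ((Psi m).differentiable.differentiableOn.div (differentiable_id.pow d).differentiableOn
      fun q hq => pow_ne_zero _ (hne q hq))
    (fun q hq => div_ne_zero (hN m hmN q hq) (pow_ne_zero _ (hne q hq)))
  have hmem : ∀ w : ℂ, ‖w‖ < R → c + w ∈ Metric.ball c R := fun w hw => by simpa using hw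
  have hre : ∀ w : ℂ, ‖w‖ < R → ‖(Psi m).eval (c + w)‖ / ‖c + w‖ ^ d =
      ‖(Psi m).eval c‖ / ‖c‖ ^ d * Real.exp (k w).re := by
    intro w hw
    have h := congrArg norm (hkF w (by simpa using hw))
    simpa only [norm_mul, norm_div, norm_pow, Complex.norm_exp] using h
  have hc0 : (0 : ℝ) < ‖c‖ ^ d := by positivity
  -- This lets the value at the centre be dropped when bounding `exp (k w).re`.
  have hlow' : 1 ≤ ‖(Psi m).eval c‖ / ‖c‖ ^ d := (one_le_div hc0).2 hlow
  have hup : ∀ w : ℂ, ‖w‖ < R → ∀ b : ℝ, 1 ≤ b → 1 ≤ b * ‖c + w‖ →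
      Real.exp (k w).re ≤ (m + 1) ^ 2 * b ^ d := by
    intro w hw b hb1 hb
    have hcw : 0 < ‖c + w‖ := norm_pos_iff.2 (hne _ (hmem w hw))
    calc Real.exp (k w).re ≤ ‖(Psi m).eval c‖ / ‖c‖ ^ d * Real.exp (k w).re :=
          le_mul_of_one_le_left (Real.exp_pos _).le hlow'
      _ = ‖(Psi m).eval (c + w)‖ / ‖c + w‖ ^ d := (hre w hw).symm
      _ ≤ _ := by
          rw [div_le_iff₀ (by positivity), mul_assoc, ← mul_pow]
          exact norm_eval_Psi_le m hb1 hb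
  have hkey := hsmall (fun w => k w / d) (hk.div_const _) (by simp [hk0])
    (by
      intro w hw
      rw [Complex.div_natCast_re, div_le_iff₀ hd0, ← Real.exp_le_exp]
      have hcw := hnorm _ (hmem w hw)
      calc Real.exp (k w).re ≤ (m + 1) ^ 2 * a ^ d := hup w hw a ha1.le
            (haR.trans (by gcongr))
        _ ≤ Real.exp (d * 1) * a ^ d := by gcongr
        _ = Real.exp ((1 + Real.log a) * d) := by
          rw [add_mul, Real.exp_add, mul_comm (Real.log a), Real.exp_nat_mul (Real.log a),
            Real.exp_log (by linarith), one_mul, mul_one])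
    (by
      intro w hw
      rw [Complex.div_natCast_re, div_le_iff₀ hd0, ← Real.exp_le_exp]
      have hw1 : ‖w‖ < ‖c‖ - 1 := hw.trans_le (min_le_right _ _)
      have hcw : 1 ≤ ‖c + w‖ := by
        have := norm_sub_le (c + w) w
        rw [add_sub_cancel_right] at this
        linarith
      calc Real.exp (k w).re ≤ (m + 1) ^ 2 * 1 ^ d :=
            hup w (hw.trans_le (min_le_left _ _)) 1 le_rfl (by linarith)
        _ ≤ Real.exp (d * ε) := by simpa using hexp
        _ = _ := by rw [mul_comm])
  have hkp : (k (p - c)).re ≤ d * δ := by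
    have h := (Complex.re_le_norm _).trans hkey
    rw [Complex.div_natCast_re, div_le_iff₀ hd0] at h
    linarith
  have hpeq := hre (p - c) hpc
  rw [add_sub_cancel, div_eq_iff (by positivity)] at hpeq
  rw [hpeq]
  have hcup : ‖(Psi m).eval c‖ / ‖c‖ ^ d ≤ (m + 1) ^ 2 := by
    rw [div_le_iff₀ hc0]
    simpa using norm_eval_Psi_le m le_rfl (q := c) (by linarith)
  calc ‖(Psi m).eval c‖ / ‖c‖ ^ d * Real.exp (k (p - c)).re * ‖p‖ ^ d
      ≤ (m + 1) ^ 2 * Real.exp (d * δ) * ‖p‖ ^ d := by gcongr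
    _ = (m + 1) ^ 2 * s ^ d := by rw [hs, mul_pow, Real.exp_nat_mul]; ring
    _ ≤ (m + 1) ^ 2 * s ^ m := by
      gcongr (m + 1) ^ 2 * ?_
      exact pow_le_pow_of_le_one hs0.le hδp.le hmd

/-- The pointwise limit of `Ψ_m` does not vanish on a nonempty open subset of the unit disc. -/
theorem not_forall_tendsto_eval_Psi_zero {p : ℂ} (hp : ‖p‖ < 1)
    (h : ∀ᶠ z in 𝓝 p, Tendsto (fun m => (Psi m).eval z) atTop (𝓝 0)) : False := by
  obtain ⟨r, hpr, hr1⟩ := exists_between hp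
  have hr0 : 0 < r := (norm_nonneg p).trans_lt hpr
  set F : ℕ → ℂ → ℂ := fun k q => (-1) ^ k * (2 * (k : ℂ) + 1) * q ^ (k * (k + 1) / 2) with hF
  set u : ℕ → ℝ := fun k => (2 * k + 1) * r ^ k with hu
  have hsum : Summable u := by
    have h1 := summable_pow_mul_geometric_of_norm_lt_one 1 (r := r)
      (by rwa [Real.norm_of_nonneg hr0.le])
    have h0 := summable_geometric_of_lt_one hr0.le hr1
    refine ((h1.mul_left 2).add h0).congr fun k => ?_
    simp only [hu]
    ring
  have hbound : ∀ k q, q ∈ Metric.ball (0 : ℂ) r → ‖F k q‖ ≤ u k := by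
    intro k q hq
    have hq' : ‖q‖ < r := by simpa using hq
    simp only [hF, hu]
    rw [norm_mul, norm_coeff, norm_pow]
    gcongr
    calc ‖q‖ ^ (k * (k + 1) / 2) ≤ r ^ (k * (k + 1) / 2) := by gcongr
      _ ≤ r ^ k := pow_le_pow_of_le_one hr0.le hr1.le (le_mul_succ_div_two k)
  have hdiff := Complex.differentiableOn_tsum_of_summable_norm hsum (F := F) (U := Metric.ball 0 r)
    (fun k => by simp only [hF]; fun_prop) Metric.isOpen_ball hbound
  have hlim : ∀ q ∈ Metric.ball (0 : ℂ) r,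
      Tendsto (fun m => (Psi m).eval q) atTop (𝓝 (∑' k, F k q)) := by
    intro q hq
    have hs : Summable fun k => F k q := Summable.of_norm_bounded hsum fun k => hbound k q hq
    refine ((tendsto_add_atTop_iff_nat 1).2 hs.hasSum.tendsto_sum_nat).congr fun m => ?_
    rw [eval_Psi]
  have hpmem : p ∈ Metric.ball (0 : ℂ) r := by simpa using hpr
  have hzero := (hdiff.analyticOnNhd Metric.isOpen_ball).eqOn_zero_of_preconnected_of_eventuallyEq_zero
    (convex_ball 0 r).isPreconnected hpmem (by
      filter_upwards [h, Metric.isOpen_ball.mem_nhds hpmem] with z hz hzr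
      exact tendsto_nhds_unique (hlim z hzr) hz)
  have h00 : (0 : ℂ) ∈ Metric.ball (0 : ℂ) r := Metric.mem_ball_self hr0
  have h1 := hlim 0 h00
  have h2 : ∑' k, F k 0 = 0 := hzero h00
  simp only [Psi_eval_zero, h2] at h1
  exact one_ne_zero (tendsto_nhds_unique tendsto_const_nhds h1)

/-- Every point of the unit circle is a limit of zeros of the polynomials `Ψ_m`. -/
theorem exists_isRoot_Psi_near {ζ : ℂ} (hζ : ‖ζ‖ = 1) {ε : ℝ} (hε : 0 < ε) (N : ℕ) :
    ∃ m ≥ N, ∃ q ∈ Metric.ball ζ ε, (Psi m).IsRoot q := by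
  by_contra! hcon
  -- The disc of radius `3t` about `(1+t)ζ` contains `(1-t)ζ`, avoids `0`, and stays within `4t ≤ ε`
  -- of `ζ`.
  set t := min ε 1 / 4 with ht
  have ht0 : 0 < t := by positivity
  have htε : 4 * t ≤ ε := by rw [ht]; linarith [min_le_left ε 1]
  have ht1 : 4 * t ≤ 1 := by rw [ht]; linarith [min_le_right ε 1]
  have hnorm : ∀ x : ℝ, ‖(x : ℂ) * ζ‖ = |x| := fun x => by simp [hζ]
  have hc : ‖((1 + t : ℝ) : ℂ) * ζ‖ = 1 + t := by rw [hnorm, abs_of_pos (by linarith)]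
  have hp : ‖((1 - t : ℝ) : ℂ) * ζ‖ < 1 := by rw [hnorm, abs_of_pos (by linarith)]; linarith
  have hpc : ((1 - t : ℝ) : ℂ) * ζ ∈ Metric.ball (((1 + t : ℝ) : ℂ) * ζ) (3 * t) := by
    rw [mem_ball_iff_norm, ← sub_mul, ← Complex.ofReal_sub, hnorm, abs_lt]
    constructor <;> linarith
  refine not_forall_tendsto_eval_Psi_zero hp ?_
  filter_upwards [Metric.isOpen_ball.mem_nhds hpc,
    (isOpen_lt continuous_norm continuous_const).mem_nhds hp] with z hz hz1
  refine tendsto_eval_Psi_zero (R := 3 * t) (by rw [hc]; linarith) (by linarith)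
    (by rw [hc]; linarith) (N := N) (fun m hm q hq => hcon m hm q ?_) hz hz1
  have hcζ : dist (((1 + t : ℝ) : ℂ) * ζ) ζ = t := by
    rw [dist_eq_norm]
    nth_rw 2 [← one_mul ζ]
    rw [← Complex.ofReal_one, ← sub_mul, ← Complex.ofReal_sub, hnorm, add_sub_cancel_left,
      abs_of_pos ht0]
  rw [Metric.mem_ball] at hq ⊢
  linarith [dist_triangle q (((1 + t : ℝ) : ℂ) * ζ) ζ]

end PartialTheta

theorem mainTheorem4 (ζ : ℂ) (hζ : ‖ζ‖ = 1) :
    ∃ (m : ℕ → ℕ) (q : ℕ → ℂ),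
      Tendsto m atTop atTop ∧
      (∀ s, q s ∈ PartialTheta.truncSpec (2 * m s + 1)) ∧
      (∀ s, (PartialTheta.Psi (m s)).IsRoot (q s)) ∧
      Tendsto q atTop (𝓝 ζ) := by
  choose m hm q hq hroot using fun s : ℕ =>
    PartialTheta.exists_isRoot_Psi_near hζ (Nat.one_div_pos_of_nat (α := ℝ) (n := s)) s
  refine ⟨m, q, tendsto_atTop_mono hm tendsto_id,
    fun s => PartialTheta.mem_truncSpec_of_isRoot_Psi (hroot s), hroot, ?_⟩
  rw [tendsto_iff_dist_tendsto_zero]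
  exact squeeze_zero (fun _ => dist_nonneg) (fun s => (Metric.mem_ball.1 (hq s)).le)
    tendsto_one_div_add_atTop_nhds_zero_nat
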